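/- For $t\in\mathbb C\setminus[16,\infty)$ the integral $$I(t)=\int_{x_1,x_2,x_3\ge 0}\frac{1}{\bigl(1+\sum_{i=1}^3x_i\bigr)\bigl(1+\sum_{i=1}^3x_i^{-1}\bigr)-t}\,\prod_{i=1}^3\frac{dx_i}{x_i}$$ (the equal-mass three-banana integral) converges absolutely and is a holomorphic function of $t$. It satisfies the inhomogeneous Picard–Fuchs equation $$\mathcal L^3_t\,I(t)=-24\qquad\text{for all } t\in\mathbb C\setminus[16,\infty),$$ where $$\mathcal L^3_t=t^2(t-4)(t-16)\frac{d^3}{dt^3}+6t(t^2-15t+32)\frac{d^2}{dt^2}+(7t^2-68t+64)\frac{d}{dt}+(t-4).$$ -/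

import Mathlib

open MeasureTheory

/-- The domain of integration. The coordinate hyperplanes, where the integrand is not defined,
are a null set and are left out. -/
def positiveOctant : Set (Fin 3 → ℝ) := {x | ∀ i, 0 < x i}

/-- The integrand of the equal-mass three-banana integral, with respect to `dx₁ dx₂ dx₃`. -/
noncomputable def bananaIntegrand (t : ℂ) (x : Fin 3 → ℝ) : ℂ :=
  1 / ((1 + ∑ i, (x i : ℂ)) * (1 + ∑ i, (x i : ℂ)⁻¹) - t) * ∏ i, 1 / (x i : ℂ)

/-- The equal-mass three-banana integral. -/
noncomputable def bananaIntegral (t : ℂ) : ℂ :=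
  ∫ x in positiveOctant, bananaIntegrand t x

/-- The plane cut along the real half-line `[16, ∞)`: the product
`(1 + ∑ xᵢ) (1 + ∑ xᵢ⁻¹)` takes exactly the values in `[16, ∞)`, so these are the `t` for which
the denominator of the integrand has no zero. -/
def bananaDomain : Set ℂ := {t | ∀ s : ℝ, 16 ≤ s → t ≠ (s : ℂ)}

/-- The Picard–Fuchs operator of order three. -/
noncomputable def picardFuchsOperator (f : ℂ → ℂ) (t : ℂ) : ℂ :=
  t ^ 2 * (t - 4) * (t - 16) * iteratedDeriv 3 f t
    + 6 * t * (t ^ 2 - 15 * t + 32) * iteratedDeriv 2 f t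
    + (7 * t ^ 2 - 68 * t + 64) * deriv f t
    + (t - 4) * f t

/-!
Write `P x = (1 + ∑ xᵢ) (1 + ∑ xᵢ⁻¹)`. On the positive octant `P ≥ 16`, so on the cut plane the
denominator `P - t` is, locally uniformly in `t`, comparable to `P`
(`exists_mul_le_norm_sub`). Hence differentiation under the integral sign is allowed, and the `k`-th
derivative of the banana integral is `k! ∫ (P - t)^(-(k+1)) ∏ dxᵢ / xᵢ`
(`iteratedDeriv_bananaIntegral`). As the cut plane is star-shaped about `0`, the identity theorem
reduces the differential equation to small `t ≠ 0`, where the geometric series gives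
`I(t) = ∑ aₙ tⁿ` with `aₙ = ∫ P^(-(n+1)) ∏ dxᵢ / xᵢ`. The equation then says that
`(n+1)³ aₙ - 2 (2n+3) (5 (n+1)² + 5 (n+1) + 2) aₙ₊₁ + 64 (n+2)³ aₙ₊₂ = 0` and
`64 a₁ - 4 a₀ = -24`.

To obtain these relations, write both factors of `P` as Laplace integrals and apply Tonelli's
theorem: `n!² aₙ = ∫₀^∞ wⁿ φ(w)⁴ dw`, where `φ(w) = ∫₀^∞ exp (-(x + w / x)) dx / x` is a Bessel
function, `φ(w) = 2 K₀(2 √w)` (`lintegral_bananaMoment`). With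
`h(w) = ∫₀^∞ exp (-(x + w / x)) dx` one has `φ' = -h / w` and `h' = -φ`. Integration by parts in the
mixed moments `∫₀^∞ wⁿ φᵃ hᵇ dw`, `a + b = 4`, gives a linear system (`besselMoment_rec`) from which
the mixed moments can be eliminated (`besselMoment_four_zero_rec`). The functions `φ` and `h` are
`O(w ^ (-s))` for each `s > 0`, so that all boundary terms vanish but one: `h(0+) = 1` makes
`∫₀^∞ φ h³ dw = 1 / 4` (`besselMoment_zero_one_three`), which becomes the right-hand side `-24`.
That the integrals `aₙ` converge is part of the same application of Tonelli's theorem.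
-/

/-! ### The Bessel functions -/

/-- The function `w ↦ ∫₀^∞ x ^ m * exp (-(x + w / x)) dx`. It equals
`2 w ^ ((m + 1) / 2) K_{m+1}(2 √w)` with `K` the modified Bessel function of the second kind. -/
noncomputable def besselIntegral (m : ℤ) (w : ℝ) : ℝ :=
  ∫ x in Set.Ioi (0 : ℝ), x ^ m * Real.exp (-(x + w / x))

theorem exp_neg_le_rpow {s y : ℝ} (hs : 0 < s) (hy : 0 < y) :
    Real.exp (-y) ≤ s ^ s * y ^ (-s) := by
  have h1 : y / s ≤ Real.exp (y / s) := by linarith [Real.add_one_le_exp (y / s)]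
  have h2 : (y / s) ^ s ≤ Real.exp (y / s) ^ s :=
    Real.rpow_le_rpow (by positivity) h1 hs.le
  rw [← Real.exp_mul, div_mul_cancel₀ _ hs.ne', Real.div_rpow hy.le hs.le,
    div_le_iff₀ (by positivity)] at h2
  rw [Real.exp_neg, Real.rpow_neg hy.le, ← div_eq_mul_inv, le_div_iff₀ (by positivity),
    inv_mul_le_iff₀ (Real.exp_pos y)]
  exact h2

theorem besselIntegrand_le {m : ℤ} {s w x : ℝ} (hs : 0 < s) (hw : 0 < w) (hx : 0 < x) :
    x ^ m * Real.exp (-(x + w / x)) ≤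
      s ^ s * w ^ (-s) * (Real.exp (-x) * x ^ (m + s + 1 - 1 : ℝ)) := by
  have h := exp_neg_le_rpow hs (div_pos hw hx)
  rw [Real.div_rpow hw.le hx.le, Real.rpow_neg hx.le, div_inv_eq_mul] at h
  rw [neg_add, Real.exp_add, add_sub_cancel_right, Real.rpow_add hx, Real.rpow_intCast]
  calc x ^ m * (Real.exp (-x) * Real.exp (-(w / x)))
      ≤ x ^ m * (Real.exp (-x) * (s ^ s * (w ^ (-s) * x ^ s))) := by gcongr
    _ = _ := by ring

theorem measurable_besselIntegrand (m : ℤ) (w : ℝ) :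
    Measurable fun x : ℝ => x ^ m * Real.exp (-(x + w / x)) := by
  fun_prop

theorem integrableOn_besselIntegrand (m : ℤ) {w : ℝ} (hw : 0 < w) :
    IntegrableOn (fun x : ℝ => x ^ m * Real.exp (-(x + w / x))) (Set.Ioi 0) := by
  have hs : 0 < |(m : ℝ)| + 1 := by positivity
  have hp : 0 < (m : ℝ) + (|(m : ℝ)| + 1) + 1 := by linarith [neg_abs_le (m : ℝ)]
  refine Integrable.mono' ((Real.GammaIntegral_convergent hp).const_mul
    ((|(m : ℝ)| + 1) ^ (|(m : ℝ)| + 1) * w ^ (-(|(m : ℝ)| + 1))))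
    (measurable_besselIntegrand m w).aestronglyMeasurable ?_
  refine (ae_restrict_iff' measurableSet_Ioi).2 (.of_forall fun x hx => ?_)
  have hx : 0 < x := hx
  rw [Real.norm_of_nonneg (by positivity)]
  exact besselIntegrand_le hs hw hx

theorem besselIntegral_le {m : ℤ} {s w : ℝ} (hs : 0 < s) (hms : 0 < m + s + 1) (hw : 0 < w) :
    besselIntegral m w ≤ s ^ s * Real.Gamma (m + s + 1) * w ^ (-s) := by
  have h : besselIntegral m w ≤ ∫ x in Set.Ioi (0 : ℝ),
      s ^ s * w ^ (-s) * (Real.exp (-x) * x ^ (m + s + 1 - 1 : ℝ)) :=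
    setIntegral_mono_on (integrableOn_besselIntegrand m hw)
      ((Real.GammaIntegral_convergent hms).const_mul _) measurableSet_Ioi
      fun x hx => besselIntegrand_le hs hw hx
  rw [integral_const_mul, ← Real.Gamma_eq_integral hms] at h
  linarith

theorem besselIntegral_nonneg (m : ℤ) (w : ℝ) : 0 ≤ besselIntegral m w :=
  setIntegral_nonneg measurableSet_Ioi fun x hx => by
    have hx : 0 < x := hx
    positivity

theorem measurable_besselIntegral (m : ℤ) : Measurable (besselIntegral m) := by
  have h : StronglyMeasurable
      (fun p : ℝ × ℝ => p.2 ^ m * Real.exp (-(p.2 + p.1 / p.2))) :=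
    Measurable.stronglyMeasurable (by fun_prop)
  exact h.integral_prod_right.measurable

theorem hasDerivAt_besselIntegral (m : ℤ) {w : ℝ} (hw : 0 < w) :
    HasDerivAt (besselIntegral m) (-besselIntegral (m - 1) w) w := by
  have key := (hasDerivAt_integral_of_dominated_loc_of_deriv_le
    (μ := volume.restrict (Set.Ioi (0 : ℝ))) (𝕜 := ℝ) (x₀ := w) (s := Set.Ioi (w / 2))
    (F := fun w x : ℝ => x ^ m * Real.exp (-(x + w / x)))
    (F' := fun w x : ℝ => -(x ^ (m - 1) * Real.exp (-(x + w / x))))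
    (bound := fun x : ℝ => x ^ (m - 1) * Real.exp (-(x + w / 2 / x)))
    (Ioi_mem_nhds (by linarith))
    (.of_forall fun w => (measurable_besselIntegrand m w).aestronglyMeasurable)
    (integrableOn_besselIntegrand m hw)
    (measurable_besselIntegrand (m - 1) w).neg.aestronglyMeasurable
    ?_ (integrableOn_besselIntegrand (m - 1) (half_pos hw)) ?_).2
  · rw [integral_neg] at key
    exact key
  · refine (ae_restrict_iff' measurableSet_Ioi).2 (.of_forall fun x hx v hv => ?_)
    have hx : 0 < x := hx
    have hv : w / 2 < v := hv
    rw [norm_neg, Real.norm_of_nonneg (by positivity)]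
    gcongr
  · refine (ae_restrict_iff' measurableSet_Ioi).2 (.of_forall fun x hx v hv => ?_)
    have hx : 0 < x := hx
    have h1 : HasDerivAt (fun v : ℝ => -(x + v / x)) (-(1 / x)) v :=
      (((hasDerivAt_id v).div_const x).const_add x).neg
    refine (h1.exp.const_mul (x ^ m)).congr_deriv ?_
    rw [zpow_sub_one₀ hx.ne']
    ring

/-- The substitution `x ↦ w / x`; it expresses the symmetry `K_{-1} = K_1`, and closes the system
of differential equations for `φ` and `h`. -/
theorem besselIntegral_zero_eq {w : ℝ} (hw : 0 < w) :
    besselIntegral 0 w = w * besselIntegral (-2) w := by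
  have himg : (fun x : ℝ => w / x) '' Set.Ioi 0 = Set.Ioi 0 := by
    ext y
    constructor
    · rintro ⟨x, hx, rfl⟩
      exact div_pos hw hx
    · intro hy
      exact ⟨w / y, div_pos hw hy, by field_simp⟩
  have h := integral_image_eq_integral_abs_deriv_smul (s := Set.Ioi (0 : ℝ))
    (f := fun x : ℝ => w / x) (f' := fun x : ℝ => w * -(x ^ 2)⁻¹) measurableSet_Ioi
    (fun x hx => by
      simpa [div_eq_mul_inv] using
        ((hasDerivAt_inv (ne_of_gt hx)).const_mul w).hasDerivWithinAt)
    (fun x hx y hy hxy => by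
      have hx : 0 < x := hx
      have hy : 0 < y := hy
      have hxy : w / x = w / y := hxy
      field_simp at hxy
      exact hxy.symm)
    (fun x : ℝ => x ^ (0 : ℤ) * Real.exp (-(x + w / x)))
  rw [himg] at h
  rw [besselIntegral, besselIntegral, h, ← integral_const_mul]
  refine setIntegral_congr_fun measurableSet_Ioi fun x hx => ?_
  have hx : 0 < x := hx
  have h2 : w / x + w / (w / x) = x + w / x := by field_simp; ring
  simp only [smul_eq_mul, h2]
  rw [abs_of_nonpos (by rw [mul_neg, neg_nonpos]; positivity), zpow_zero,
    show (-2 : ℤ) = -((2 : ℕ) : ℤ) by rfl, zpow_neg, zpow_natCast]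
  ring

theorem hasDerivAt_besselIntegral_neg_one {w : ℝ} (hw : 0 < w) :
    HasDerivAt (besselIntegral (-1)) (-(besselIntegral 0 w / w)) w := by
  convert hasDerivAt_besselIntegral (-1) hw using 1
  rw [besselIntegral_zero_eq hw, mul_div_cancel_left₀ _ hw.ne']
  rfl

theorem hasDerivAt_besselIntegral_zero {w : ℝ} (hw : 0 < w) :
    HasDerivAt (besselIntegral 0) (-besselIntegral (-1) w) w :=
  hasDerivAt_besselIntegral 0 hw

theorem tendsto_besselIntegral_zero :
    Filter.Tendsto (besselIntegral 0) (nhdsWithin 0 (Set.Ioi 0)) (nhds 1) := by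
  rw [← integral_exp_neg_Ioi_zero]
  refine tendsto_integral_filter_of_dominated_convergence (fun x => Real.exp (-x))
    (.of_forall fun w => (measurable_besselIntegrand 0 w).aestronglyMeasurable) ?_
    (integrableOn_exp_neg_Ioi 0) ?_
  · filter_upwards [self_mem_nhdsWithin] with w hw
    refine (ae_restrict_iff' measurableSet_Ioi).2 (.of_forall fun x hx => ?_)
    have hx : 0 < x := hx
    have hw : 0 < w := hw
    rw [zpow_zero, one_mul, Real.norm_of_nonneg (by positivity)]
    gcongr
    have : 0 < w / x := by positivity
    linarith
  · refine .of_forall fun x => tendsto_nhdsWithin_of_tendsto_nhds ?_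
    have : Continuous fun w : ℝ => x ^ (0 : ℤ) * Real.exp (-(x + w / x)) := by fun_prop
    simpa using this.tendsto 0

/-- Both functions are `O(w ^ (-s))` on the whole half-line, for every `s > 0`. A small `s` serves
near `0`, a large one near `∞`. -/
theorem exists_besselIntegral_le {s : ℝ} (hs : 0 < s) :
    ∃ C, ∀ w, 0 < w → besselIntegral (-1) w ≤ C * w ^ (-s) ∧ besselIntegral 0 w ≤ C * w ^ (-s) := by
  refine ⟨max (s ^ s * Real.Gamma ((-1 : ℤ) + s + 1)) (s ^ s * Real.Gamma ((0 : ℤ) + s + 1)),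
    fun w hw => ⟨?_, ?_⟩⟩
  · refine (besselIntegral_le hs (by push_cast; linarith) hw).trans ?_
    gcongr
    exact le_max_left _ _
  · refine (besselIntegral_le hs (by push_cast; linarith) hw).trans ?_
    gcongr
    exact le_max_right _ _

/-! ### Moments of the Bessel functions -/

/-- The integrand of the mixed moments `∫₀^∞ w ^ n φ(w) ^ a h(w) ^ b dw`, where
`φ = besselIntegral (-1)` and `h = besselIntegral 0`. -/
noncomputable def besselMonomial (n a b : ℕ) (w : ℝ) : ℝ :=
  w ^ n * besselIntegral (-1) w ^ a * besselIntegral 0 w ^ b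

/-- The mixed moment `∫₀^∞ w ^ n φ(w) ^ a h(w) ^ b dw`. -/
noncomputable def besselMoment (n a b : ℕ) : ℝ :=
  ∫ w in Set.Ioi (0 : ℝ), besselMonomial n a b w

theorem besselMonomial_nonneg (n a b : ℕ) {w : ℝ} (hw : 0 < w) : 0 ≤ besselMonomial n a b w := by
  have h1 := besselIntegral_nonneg (-1) w
  have h2 := besselIntegral_nonneg 0 w
  unfold besselMonomial
  positivity

theorem measurable_besselMonomial (n a b : ℕ) : Measurable (besselMonomial n a b) :=
  ((measurable_id.pow_const n).mul ((measurable_besselIntegral (-1)).pow_const a)).mul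
    ((measurable_besselIntegral 0).pow_const b)

theorem exists_besselMonomial_le (n : ℕ) {a b : ℕ} (hab : a + b = 4) {r : ℝ} (hr : 0 < n + r) :
    ∃ C, ∀ w, 0 < w → besselMonomial n a b w ≤ C * w ^ (-r) := by
  obtain ⟨C, hC⟩ := exists_besselIntegral_le (s := (n + r) / 4) (by positivity)
  refine ⟨C ^ 4, fun w hw => ?_⟩
  obtain ⟨h1, h2⟩ := hC w hw
  have h1' := besselIntegral_nonneg (-1) w
  have h2' := besselIntegral_nonneg 0 w
  have h3 := h1'.trans h1
  have h4 := h2'.trans h2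
  calc besselMonomial n a b w
      ≤ w ^ n * (C * w ^ (-((n + r) / 4))) ^ a * (C * w ^ (-((n + r) / 4))) ^ b := by
        unfold besselMonomial
        gcongr
    _ = C ^ 4 * (w ^ n * (w ^ (-((n + r) / 4))) ^ 4) := by
        rw [mul_assoc, ← pow_add, hab]
        ring
    _ = C ^ 4 * w ^ (-r) := by
        rw [← Real.rpow_natCast w n, ← Real.rpow_mul_natCast hw.le,
          ← Real.rpow_add hw]
        congr 2
        push_cast
        ring

theorem integrableOn_besselMonomial (n : ℕ) {a b : ℕ} (hab : a + b = 4) :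
    IntegrableOn (besselMonomial n a b) (Set.Ioi 0) := by
  rw [← Set.Ioc_union_Ioi_eq_Ioi zero_le_one]
  refine IntegrableOn.union ?_ ?_
  · obtain ⟨C, hC⟩ := exists_besselMonomial_le n hab (r := 1 / 2) (by positivity)
    have hi : IntegrableOn (fun w : ℝ => w ^ (-(1 / 2) : ℝ)) (Set.Ioc 0 1) :=
      (intervalIntegrable_iff_integrableOn_Ioc_of_le zero_le_one).1
        (intervalIntegral.intervalIntegrable_rpow' (by norm_num))
    refine Integrable.mono' (hi.const_mul C)
      (measurable_besselMonomial n a b).aestronglyMeasurable ?_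
    refine (ae_restrict_iff' measurableSet_Ioc).2 (.of_forall fun w hw => ?_)
    rw [Real.norm_of_nonneg (besselMonomial_nonneg n a b hw.1)]
    exact hC w hw.1
  · obtain ⟨C, hC⟩ := exists_besselMonomial_le n hab (r := 2) (by positivity)
    refine Integrable.mono' ((integrableOn_Ioi_rpow_of_lt (a := -2) (by norm_num)
      zero_lt_one).const_mul C) (measurable_besselMonomial n a b).aestronglyMeasurable ?_
    refine (ae_restrict_iff' measurableSet_Ioi).2 (.of_forall fun w hw => ?_)
    have hw : 0 < w := zero_lt_one.trans hw
    rw [Real.norm_of_nonneg (besselMonomial_nonneg n a b hw)]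
    exact hC w hw

theorem tendsto_besselMonomial_zero (n : ℕ) {a b : ℕ} (hab : a + b = 4) :
    Filter.Tendsto (besselMonomial (n + 1) a b) (nhdsWithin 0 (Set.Ioi 0)) (nhds 0) := by
  obtain ⟨C, hC⟩ := exists_besselMonomial_le (n + 1) hab (r := -(1 / 2))
    (by push_cast; linarith [n.cast_nonneg (α := ℝ)])
  have hlim : Filter.Tendsto (fun w : ℝ => C * w ^ (-(-(1 / 2)) : ℝ))
      (nhdsWithin 0 (Set.Ioi 0)) (nhds 0) := by
    refine tendsto_nhdsWithin_of_tendsto_nhds ?_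
    have : Continuous fun w : ℝ => C * w ^ (-(-(1 / 2)) : ℝ) :=
      continuous_const.mul (Real.continuous_rpow_const (by norm_num))
    simpa using this.tendsto 0
  refine squeeze_zero' ?_ ?_ hlim
  · filter_upwards [self_mem_nhdsWithin] with w hw using besselMonomial_nonneg _ _ _ hw
  · filter_upwards [self_mem_nhdsWithin] with w hw using hC w hw

theorem tendsto_besselMonomial_atTop (n : ℕ) {a b : ℕ} (hab : a + b = 4) :
    Filter.Tendsto (besselMonomial n a b) Filter.atTop (nhds 0) := by
  obtain ⟨C, hC⟩ := exists_besselMonomial_le n hab (r := 1) (by positivity)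
  have hlim : Filter.Tendsto (fun w : ℝ => C * w ^ (-1 : ℝ)) Filter.atTop (nhds 0) := by
    simpa using (tendsto_rpow_neg_atTop zero_lt_one).const_mul C
  refine squeeze_zero' ?_ ?_ hlim
  · filter_upwards [Filter.eventually_gt_atTop 0] with w hw using besselMonomial_nonneg _ _ _ hw
  · filter_upwards [Filter.eventually_gt_atTop 0] with w hw using hC w hw

/-- The fundamental theorem of calculus on `(0, ∞)`, for a function that need not be continuous
at `0`. -/
theorem integral_Ioi_eq_sub_of_tendsto {f f' : ℝ → ℝ} {l m : ℝ}
    (hderiv : ∀ x, 0 < x → HasDerivAt f (f' x) x) (hint : IntegrableOn f' (Set.Ioi 0))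
    (hl : Filter.Tendsto f (nhdsWithin 0 (Set.Ioi 0)) (nhds l))
    (hm : Filter.Tendsto f Filter.atTop (nhds m)) :
    ∫ x in Set.Ioi (0 : ℝ), f' x = m - l := by
  have h := integral_Ioi_of_hasDerivAt_of_tendsto (f := Function.update f 0 l) (f' := f')
    (a := 0) (m := m) ?_ ?_ hint ?_
  · simpa using h
  · rwa [continuousWithinAt_update_same, Set.Ici_sdiff_left]
  · intro x hx
    refine (hderiv x hx).congr_of_eventuallyEq ?_
    filter_upwards [eventually_ne_nhds (ne_of_gt hx)] with y hy
    exact Function.update_of_ne hy _ _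
  · refine hm.congr' ?_
    filter_upwards [Filter.eventually_ne_atTop 0] with y hy
    exact (Function.update_of_ne hy _ _).symm

theorem hasDerivAt_besselMonomial (n a b : ℕ) {w : ℝ} (hw : 0 < w) :
    HasDerivAt (besselMonomial n a b)
      ((n * w ^ (n - 1) * besselIntegral (-1) w ^ a +
          w ^ n * (a * besselIntegral (-1) w ^ (a - 1) * -(besselIntegral 0 w / w))) *
        besselIntegral 0 w ^ b +
      w ^ n * besselIntegral (-1) w ^ a *
        (b * besselIntegral 0 w ^ (b - 1) * -besselIntegral (-1) w)) w :=
  ((hasDerivAt_pow n w).mul ((hasDerivAt_besselIntegral_neg_one hw).pow a)).mul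
    ((hasDerivAt_besselIntegral_zero hw).pow b)

/-- Integration by parts for the moments; all boundary terms vanish. -/
theorem besselMoment_rec (n a b : ℕ) (hab : a + b = 2) :
    (n + 1) * besselMoment n (a + 1) (b + 1) =
      (a + 1) * besselMoment n a (b + 2) + (b + 1) * besselMoment (n + 1) (a + 2) b := by
  have i1 := (integrableOn_besselMonomial n (a := a + 1) (b := b + 1) (by omega)).const_mul
    (n + 1 : ℝ)
  have i2 := (integrableOn_besselMonomial n (a := a) (b := b + 2) (by omega)).const_mul
    (a + 1 : ℝ)
  have i3 := (integrableOn_besselMonomial (n + 1) (a := a + 2) (b := b) (by omega)).const_mul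
    (b + 1 : ℝ)
  have i23 : IntegrableOn (fun w => (a + 1) * besselMonomial n a (b + 2) w +
      (b + 1) * besselMonomial (n + 1) (a + 2) b w) (Set.Ioi 0) := i2.add i3
  have key := integral_Ioi_eq_sub_of_tendsto
    (fun w hw => (hasDerivAt_besselMonomial (n + 1) (a + 1) (b + 1) hw).congr_deriv
      (g' := (n + 1) * besselMonomial n (a + 1) (b + 1) w -
        ((a + 1) * besselMonomial n a (b + 2) w +
          (b + 1) * besselMonomial (n + 1) (a + 2) b w)) ?_)
    (i1.sub i23)
    (tendsto_besselMonomial_zero n (by omega)) (tendsto_besselMonomial_atTop (n + 1) (by omega))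
  · rw [integral_sub i1 i23, integral_add i2 i3, integral_const_mul, integral_const_mul,
      integral_const_mul] at key
    unfold besselMoment
    linarith
  · simp only [besselMonomial, Nat.add_sub_cancel]
    push_cast
    field_simp
    ring

theorem besselMoment_rec_left (n : ℕ) :
    (n + 1) * besselMoment n 4 0 = 4 * besselMoment n 3 1 := by
  have i1 := (integrableOn_besselMonomial n (a := 4) (b := 0) rfl).const_mul (n + 1 : ℝ)
  have i2 := (integrableOn_besselMonomial n (a := 3) (b := 1) rfl).const_mul 4
  have key := integral_Ioi_eq_sub_of_tendsto
    (fun w hw => (hasDerivAt_besselMonomial (n + 1) 4 0 hw).congr_deriv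
      (g' := (n + 1) * besselMonomial n 4 0 w - 4 * besselMonomial n 3 1 w) ?_) (i1.sub i2)
    (tendsto_besselMonomial_zero n rfl) (tendsto_besselMonomial_atTop (n + 1) rfl)
  · rw [integral_sub i1 i2, integral_const_mul, integral_const_mul] at key
    unfold besselMoment
    linarith
  · simp only [besselMonomial, Nat.add_sub_cancel]
    push_cast
    field_simp
    ring

theorem besselMoment_rec_right (n : ℕ) :
    (n + 1) * besselMoment n 0 4 = 4 * besselMoment (n + 1) 1 3 := by
  have i1 := (integrableOn_besselMonomial n (a := 0) (b := 4) rfl).const_mul (n + 1 : ℝ)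
  have i2 := (integrableOn_besselMonomial (n + 1) (a := 1) (b := 3) rfl).const_mul 4
  have key := integral_Ioi_eq_sub_of_tendsto
    (fun w hw => (hasDerivAt_besselMonomial (n + 1) 0 4 hw).congr_deriv
      (g' := (n + 1) * besselMonomial n 0 4 w - 4 * besselMonomial (n + 1) 1 3 w) ?_)
    (i1.sub i2) (tendsto_besselMonomial_zero n rfl) (tendsto_besselMonomial_atTop (n + 1) rfl)
  · rw [integral_sub i1 i2, integral_const_mul, integral_const_mul] at key
    unfold besselMoment
    linarith
  · simp only [besselMonomial, Nat.add_sub_cancel]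
    push_cast
    ring

/-- The only moment identity with a boundary term: it comes from `h(0+) = 1`, and produces the
inhomogeneity of the differential equation. -/
theorem besselMoment_zero_one_three : besselMoment 0 1 3 = 1 / 4 := by
  have i1 := (integrableOn_besselMonomial 0 (a := 1) (b := 3) rfl).const_mul (-4)
  have hl : Filter.Tendsto (besselMonomial 0 0 4) (nhdsWithin 0 (Set.Ioi 0)) (nhds 1) := by
    have h := tendsto_besselIntegral_zero.pow 4
    rw [one_pow] at h
    exact h.congr fun w => by simp [besselMonomial]
  have key := integral_Ioi_eq_sub_of_tendsto
    (fun w hw => (hasDerivAt_besselMonomial 0 0 4 hw).congr_deriv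
      (g' := -4 * besselMonomial 0 1 3 w) ?_) i1 hl (tendsto_besselMonomial_atTop 0 rfl)
  · rw [integral_const_mul] at key
    unfold besselMoment
    linarith
  · simp only [besselMonomial]
    push_cast
    ring

/-- The exceptional first relation, which carries the boundary term at `w = 0`. -/
theorem besselMoment_four_zero_rec_zero :
    64 * besselMoment 1 4 0 - 4 * besselMoment 0 4 0 = -24 := by
  have a0 := besselMoment_rec_left 0
  have a1 := besselMoment_rec 0 2 0 rfl
  have a2 := besselMoment_rec 0 1 1 rfl
  have b0 := besselMoment_rec_left 1
  have h := besselMoment_zero_one_three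
  norm_num at a0 a1 a2 b0
  linarith

/-- Elimination of the mixed moments leaves a three-term recurrence for `∫₀^∞ w ^ n φ(w) ^ 4 dw`. -/
theorem besselMoment_four_zero_rec (n : ℕ) :
    (n + 1 : ℝ) ^ 5 * besselMoment n 4 0 -
      2 * (2 * n + 3) * (5 * (n + 1) ^ 2 + 5 * (n + 1) + 2) * besselMoment (n + 1) 4 0 +
      64 * (n + 2) * besselMoment (n + 2) 4 0 = 0 := by
  have a0 := besselMoment_rec_left n
  have a1 := besselMoment_rec n 2 0 rfl
  have a2 := besselMoment_rec n 1 1 rfl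
  have a3 := besselMoment_rec n 0 2 rfl
  have a4 := besselMoment_rec_right n
  have b0 := besselMoment_rec_left (n + 1)
  have b1 := besselMoment_rec (n + 1) 2 0 rfl
  have b2 := besselMoment_rec (n + 1) 1 1 rfl
  have c0 := besselMoment_rec_left (n + 2)
  norm_num at a1 a2 a3 b0 b1 b2 c0
  have e1 : besselMoment n 3 1 = (n + 1) * besselMoment n 4 0 / 4 := by linarith
  have e2 : besselMoment n 2 2 =
      ((n + 1) * besselMoment n 3 1 - besselMoment (n + 1) 4 0) / 3 := by linarith
  have f1 : besselMoment (n + 1) 3 1 = (n + 2) * besselMoment (n + 1) 4 0 / 4 := by linarith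
  have f2 : besselMoment (n + 1) 2 2 =
      ((n + 2) * besselMoment (n + 1) 3 1 - besselMoment (n + 2) 4 0) / 3 := by linarith
  have e3 : besselMoment n 1 3 =
      ((n + 1) * besselMoment n 2 2 - 2 * besselMoment (n + 1) 3 1) / 2 := by linarith
  have e4 : besselMoment n 0 4 =
      (n + 1) * besselMoment n 1 3 - 3 * besselMoment (n + 1) 2 2 := by linarith
  have g1 : besselMoment (n + 2) 3 1 = (n + 3) * besselMoment (n + 2) 4 0 / 4 := by linarith
  have f3 : besselMoment (n + 1) 1 3 =
      ((n + 2) * besselMoment (n + 1) 2 2 - 2 * besselMoment (n + 2) 3 1) / 2 := by linarith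
  rw [e4, e3, e2, e1, f3, f2, f1, g1] at a4
  linear_combination 24 * a4

/-! ### Moments of the banana denominator -/

/-- The product `(1 + ∑ xᵢ) (1 + ∑ xᵢ⁻¹)`. -/
noncomputable def bananaDenominator (x : Fin 3 → ℝ) : ℝ := (1 + ∑ i, x i) * (1 + ∑ i, (x i)⁻¹)

/-- The value of `∫ (bananaDenominator x)^(-(n+1)) ∏ dxᵢ / xᵢ`, the `n`-th Taylor coefficient of
the banana integral at `0`. -/
noncomputable def bananaMoment (n : ℕ) : ℝ :=
  ∫ x in positiveOctant, (bananaDenominator x)⁻¹ ^ (n + 1) * ∏ i, (x i)⁻¹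

theorem positiveOctant_eq_pi : positiveOctant = Set.univ.pi fun _ : Fin 3 => Set.Ioi (0 : ℝ) := by
  ext x
  simp [positiveOctant]

theorem measurableSet_positiveOctant : MeasurableSet positiveOctant := by
  rw [positiveOctant_eq_pi]
  exact MeasurableSet.univ_pi fun _ => measurableSet_Ioi

theorem measurable_bananaDenominator : Measurable bananaDenominator := by
  unfold bananaDenominator
  fun_prop

theorem bananaDenominator_ge {x : Fin 3 → ℝ} (hx : x ∈ positiveOctant) :
    16 ≤ bananaDenominator x := by
  have h0 := hx 0
  have h1 := hx 1
  have h2 := hx 2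
  -- The product expands to `4` plus six sums of the form `a / b + b / a`.
  have key : ∀ a b : ℝ, 0 < a → 0 < b → 2 ≤ a * b⁻¹ + b * a⁻¹ := fun a b ha hb => by
    rw [← sub_nonneg]
    have : a * b⁻¹ + b * a⁻¹ - 2 = (a - b) ^ 2 * (a⁻¹ * b⁻¹) := by field_simp; ring
    rw [this]
    positivity
  have k1 := key _ _ h0 one_pos
  have k2 := key _ _ h1 one_pos
  have k3 := key _ _ h2 one_pos
  have k4 := key _ _ h0 h1
  have k5 := key _ _ h0 h2
  have k6 := key _ _ h1 h2
  simp only [bananaDenominator, Fin.sum_univ_three]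
  have e0 := mul_inv_cancel₀ h0.ne'
  have e1 := mul_inv_cancel₀ h1.ne'
  have e2 := mul_inv_cancel₀ h2.ne'
  simp only [inv_one, mul_one, one_mul] at k1 k2 k3
  linarith

theorem integral_pow_mul_exp_neg (n : ℕ) {a : ℝ} (ha : 0 < a) :
    IntegrableOn (fun u : ℝ => u ^ n * Real.exp (-(a * u))) (Set.Ioi 0) ∧
      ∫ u in Set.Ioi (0 : ℝ), u ^ n * Real.exp (-(a * u)) = n.factorial * a⁻¹ ^ (n + 1) := by
  have h := Real.integral_rpow_mul_exp_neg_mul_Ioi (a := n + 1) (by positivity) ha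
  rw [Real.Gamma_nat_eq_factorial] at h
  have h' : ∫ u in Set.Ioi (0 : ℝ), u ^ n * Real.exp (-(a * u)) =
      n.factorial * a⁻¹ ^ (n + 1) := by
    rw [one_div, ← Nat.cast_succ, Real.rpow_natCast, Nat.succ_eq_add_one, mul_comm] at h
    rw [← h]
    simp
  refine ⟨?_, h'⟩
  -- The integral is positive, so it is not the junk value of a divergent integral.
  by_contra hc
  rw [integral_undef hc] at h'
  have : (0 : ℝ) < n.factorial * a⁻¹ ^ (n + 1) := by positivity
  exact this.ne h'

theorem lintegral_ofReal_pow_mul_exp_neg (n : ℕ) {a c : ℝ} (ha : 0 < a) (hc : 0 ≤ c) :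
    ∫⁻ u in Set.Ioi (0 : ℝ), ENNReal.ofReal (c * (u ^ n * Real.exp (-(a * u)))) =
      ENNReal.ofReal (c * (n.factorial * a⁻¹ ^ (n + 1))) := by
  obtain ⟨hi, h⟩ := integral_pow_mul_exp_neg n ha
  rw [← h, ← integral_const_mul, ofReal_integral_eq_lintegral_ofReal (hi.const_mul c)]
  refine (ae_restrict_iff' measurableSet_Ioi).2 (.of_forall fun x hx => ?_)
  have hx : 0 < x := hx
  simp only [Pi.zero_apply]
  positivity

theorem lintegral_ofReal_besselIntegrand {w c : ℝ} (hw : 0 < w) (hc : 0 ≤ c) :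
    ∫⁻ x in Set.Ioi (0 : ℝ), ENNReal.ofReal (c * (x⁻¹ * Real.exp (-(x + w / x)))) =
      ENNReal.ofReal (c * besselIntegral (-1) w) := by
  have hi := integrableOn_besselIntegrand (-1) hw
  rw [besselIntegral, ← integral_const_mul, ofReal_integral_eq_lintegral_ofReal (hi.const_mul c)]
  · simp
  refine (ae_restrict_iff' measurableSet_Ioi).2 (.of_forall fun x hx => ?_)
  have hx : 0 < x := hx
  simp only [Pi.zero_apply]
  positivity

theorem lintegral_Ioi_comp_mul_left (f : ℝ → ENNReal) {b : ℝ} (hb : 0 < b) :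
    ∫⁻ u in Set.Ioi (0 : ℝ), f u = ∫⁻ u in Set.Ioi (0 : ℝ), ENNReal.ofReal b * f (b * u) := by
  have himg : (fun x : ℝ => b * x) '' Set.Ioi 0 = Set.Ioi 0 := by
    ext y
    constructor
    · rintro ⟨x, hx, rfl⟩
      exact mul_pos hb hx
    · intro hy
      exact ⟨y / b, div_pos hy hb, by field_simp⟩
  have h := lintegral_image_eq_lintegral_abs_deriv_mul (s := Set.Ioi (0 : ℝ))
    (f := fun x : ℝ => b * x) (f' := fun _ => b) measurableSet_Ioi
    (fun x _ => by simpa using ((hasDerivAt_id x).const_mul b).hasDerivWithinAt)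
    (fun x _ y _ hxy => mul_left_cancel₀ hb.ne' hxy) f
  rwa [himg, abs_of_pos hb] at h

theorem integral_inv_mul_exp {α β : ℝ} (hα : 0 < α) (hβ : 0 < β) :
    IntegrableOn (fun x : ℝ => x⁻¹ * Real.exp (-(α * x + β * x⁻¹))) (Set.Ioi 0) ∧
      ∫ x in Set.Ioi (0 : ℝ), x⁻¹ * Real.exp (-(α * x + β * x⁻¹)) =
        besselIntegral (-1) (α * β) := by
  have hfun : ∀ x : ℝ, x⁻¹ * Real.exp (-(α * x + β * x⁻¹)) =
      α * ((α * x) ^ (-1 : ℤ) * Real.exp (-(α * x + α * β / (α * x)))) := fun x => by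
    rw [mul_div_mul_left _ _ hα.ne', zpow_neg_one, mul_inv, div_eq_mul_inv, ← mul_assoc,
      mul_inv_cancel_left₀ hα.ne']
  simp_rw [hfun]
  constructor
  · refine Integrable.const_mul ?_ α
    have := integrableOn_besselIntegrand (-1) (mul_pos hα hβ)
    have h2 := (integrableOn_Ioi_comp_mul_left_iff
      (fun x : ℝ => x ^ (-1 : ℤ) * Real.exp (-(x + α * β / x))) 0 hα).2
    rw [mul_zero] at h2
    exact h2 this
  · rw [integral_const_mul, integral_comp_mul_left_Ioi
      (fun x : ℝ => x ^ (-1 : ℤ) * Real.exp (-(x + α * β / x))) 0 hα, mul_zero, smul_eq_mul,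
      mul_inv_cancel_left₀ hα.ne']
    rfl

theorem volume_restrict_positiveOctant :
    (volume : Measure (Fin 3 → ℝ)).restrict positiveOctant =
      Measure.pi fun _ => (volume : Measure ℝ).restrict (Set.Ioi 0) := by
  rw [positiveOctant_eq_pi, volume_pi, Measure.restrict_pi_pi]

theorem lintegral_positiveOctant {α β c : ℝ} (hα : 0 < α) (hβ : 0 < β) (hc : 0 ≤ c) :
    ∫⁻ x in positiveOctant,
      ENNReal.ofReal (c * ∏ i, ((x i)⁻¹ * Real.exp (-(α * x i + β * (x i)⁻¹)))) =
      ENNReal.ofReal (c * besselIntegral (-1) (α * β) ^ 3) := by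
  obtain ⟨hi, h⟩ := integral_inv_mul_exp hα hβ
  rw [volume_restrict_positiveOctant, ← ofReal_integral_eq_lintegral_ofReal,
    integral_const_mul, integral_fintype_prod_eq_prod
      (f := fun (_ : Fin 3) (y : ℝ) => y⁻¹ * Real.exp (-(α * y + β * y⁻¹)))]
  · rw [h, Finset.prod_const, Finset.card_univ, Fintype.card_fin]
  · exact (Integrable.fintype_prod fun _ => hi).const_mul c
  · rw [← volume_restrict_positiveOctant]
    refine (ae_restrict_iff' measurableSet_positiveOctant).2 (.of_forall fun x hx => ?_)
    exact mul_nonneg hc (Finset.prod_nonneg fun i _ =>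
      mul_nonneg (inv_nonneg.2 (hx i).le) (Real.exp_pos _).le)

/-- Tonelli's theorem, after the two factors of the denominator have been written as Laplace
integrals, turns the moments of the banana integral into moments of the fourth power of a Bessel
function. -/
theorem lintegral_bananaMoment (n : ℕ) :
    ∫⁻ x in positiveOctant, ENNReal.ofReal
        ((n.factorial : ℝ) ^ 2 * ((bananaDenominator x)⁻¹ ^ (n + 1) * ∏ i, (x i)⁻¹)) =
      ∫⁻ w in Set.Ioi (0 : ℝ), ENNReal.ofReal (besselMonomial n 4 0 w) := by
  set φ := besselIntegral (-1) with hφ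
  have hφm : Measurable φ := measurable_besselIntegral (-1)
  have hφ0 : ∀ w, 0 ≤ φ w := besselIntegral_nonneg (-1)
  have laplace : ∀ x ∈ positiveOctant, ENNReal.ofReal
        ((n.factorial : ℝ) ^ 2 * ((bananaDenominator x)⁻¹ ^ (n + 1) * ∏ i, (x i)⁻¹)) =
      ∫⁻ α in Set.Ioi (0 : ℝ), ∫⁻ β in Set.Ioi (0 : ℝ), ENNReal.ofReal
        (α ^ n * β ^ n * Real.exp (-(α + β)) *
          ∏ i, ((x i)⁻¹ * Real.exp (-(α * x i + β * (x i)⁻¹)))) := by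
    intro x hx
    have hx0 : ∀ i, 0 < x i := hx
    have hp : 0 ≤ ∏ i, (x i)⁻¹ := Finset.prod_nonneg fun i _ => (inv_pos.2 (hx0 i)).le
    have hA : 0 < 1 + ∑ i, x i :=
      add_pos_of_pos_of_nonneg one_pos (Finset.sum_nonneg fun i _ => (hx0 i).le)
    have hB : 0 < 1 + ∑ i, (x i)⁻¹ :=
      add_pos_of_pos_of_nonneg one_pos (Finset.sum_nonneg fun i _ => (inv_pos.2 (hx0 i)).le)
    have hsplit : ∀ α β : ℝ, α ^ n * β ^ n * Real.exp (-(α + β)) *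
          ∏ i, ((x i)⁻¹ * Real.exp (-(α * x i + β * (x i)⁻¹))) =
        ((∏ i, (x i)⁻¹) * (α ^ n * Real.exp (-((1 + ∑ i, x i) * α)))) *
          (β ^ n * Real.exp (-((1 + ∑ i, (x i)⁻¹) * β))) := fun α β => by
      have he : Real.exp (-(α + β)) * ∏ i, Real.exp (-(α * x i + β * (x i)⁻¹)) =
          Real.exp (-((1 + ∑ i, x i) * α)) * Real.exp (-((1 + ∑ i, (x i)⁻¹) * β)) := by
        rw [← Real.exp_sum, ← Real.exp_add, ← Real.exp_add, Finset.sum_neg_distrib,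
          Finset.sum_add_distrib, ← Finset.mul_sum, ← Finset.mul_sum]
        congr 1
        ring
      rw [Finset.prod_mul_distrib]
      linear_combination (α ^ n * β ^ n * ∏ i, (x i)⁻¹) * he
    have inner : ∀ α ∈ Set.Ioi (0 : ℝ), ∫⁻ β in Set.Ioi (0 : ℝ), ENNReal.ofReal
        (α ^ n * β ^ n * Real.exp (-(α + β)) *
          ∏ i, ((x i)⁻¹ * Real.exp (-(α * x i + β * (x i)⁻¹)))) =
        ENNReal.ofReal (((∏ i, (x i)⁻¹) * (n.factorial * (1 + ∑ i, (x i)⁻¹)⁻¹ ^ (n + 1))) *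
          (α ^ n * Real.exp (-((1 + ∑ i, x i) * α)))) := fun α hα => by
      have hα : 0 < α := hα
      simp_rw [hsplit]
      rw [lintegral_ofReal_pow_mul_exp_neg n hB (by positivity)]
      congr 1
      ring
    rw [setLIntegral_congr_fun measurableSet_Ioi inner,
      lintegral_ofReal_pow_mul_exp_neg n hA (by positivity), bananaDenominator, mul_inv, mul_pow]
    congr 1
    ring
  have swap_x : ∫⁻ x in positiveOctant, ∫⁻ α in Set.Ioi (0 : ℝ), ∫⁻ β in Set.Ioi (0 : ℝ),
        ENNReal.ofReal (α ^ n * β ^ n * Real.exp (-(α + β)) *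
          ∏ i, ((x i)⁻¹ * Real.exp (-(α * x i + β * (x i)⁻¹)))) =
      ∫⁻ α in Set.Ioi (0 : ℝ), ∫⁻ β in Set.Ioi (0 : ℝ), ∫⁻ x in positiveOctant,
        ENNReal.ofReal (α ^ n * β ^ n * Real.exp (-(α + β)) *
          ∏ i, ((x i)⁻¹ * Real.exp (-(α * x i + β * (x i)⁻¹)))) := by
    rw [lintegral_lintegral_swap]
    · refine lintegral_congr fun α => ?_
      rw [lintegral_lintegral_swap]
      refine Measurable.aemeasurable ?_
      unfold Function.uncurry
      fun_prop
    · refine Measurable.aemeasurable ?_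
      unfold Function.uncurry
      refine Measurable.lintegral_prod_right' (f := fun p : ((Fin 3 → ℝ) × ℝ) × ℝ =>
        ENNReal.ofReal (p.1.2 ^ n * p.2 ^ n * Real.exp (-(p.1.2 + p.2)) *
          ∏ i, ((p.1.1 i)⁻¹ * Real.exp (-(p.1.2 * p.1.1 i + p.2 * (p.1.1 i)⁻¹))))) ?_
      fun_prop
  have inner : ∀ α ∈ Set.Ioi (0 : ℝ), ∫⁻ β in Set.Ioi (0 : ℝ), ∫⁻ x in positiveOctant,
        ENNReal.ofReal (α ^ n * β ^ n * Real.exp (-(α + β)) *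
          ∏ i, ((x i)⁻¹ * Real.exp (-(α * x i + β * (x i)⁻¹)))) =
      ∫⁻ w in Set.Ioi (0 : ℝ), ENNReal.ofReal
        (w ^ n * φ w ^ 3 * (α⁻¹ * Real.exp (-(α + w / α)))) := fun α hα => by
    have hα : 0 < α := hα
    rw [lintegral_Ioi_comp_mul_left (fun w => ENNReal.ofReal
        (w ^ n * φ w ^ 3 * (α⁻¹ * Real.exp (-(α + w / α))))) hα]
    refine setLIntegral_congr_fun measurableSet_Ioi fun β hβ => ?_
    have hβ : 0 < β := hβ
    rw [lintegral_positiveOctant hα hβ (by positivity), ← ENNReal.ofReal_mul hα.le,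
      mul_div_cancel_left₀ _ hα.ne', mul_pow]
    congr 1
    field_simp
    rfl
  have outer : ∀ w ∈ Set.Ioi (0 : ℝ), ∫⁻ α in Set.Ioi (0 : ℝ), ENNReal.ofReal
        (w ^ n * φ w ^ 3 * (α⁻¹ * Real.exp (-(α + w / α)))) =
      ENNReal.ofReal (besselMonomial n 4 0 w) := fun w hw => by
    have hw : 0 < w := hw
    have := hφ0 w
    rw [lintegral_ofReal_besselIntegrand hw (by positivity)]
    congr 1
    simp only [besselMonomial, ← hφ]
    ring
  rw [setLIntegral_congr_fun measurableSet_positiveOctant laplace, swap_x,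
    setLIntegral_congr_fun measurableSet_Ioi inner, lintegral_lintegral_swap,
    setLIntegral_congr_fun measurableSet_Ioi outer]
  refine Measurable.aemeasurable ?_
  unfold Function.uncurry
  fun_prop

theorem bananaMoment_integrand_nonneg (n : ℕ) {x : Fin 3 → ℝ} (hx : x ∈ positiveOctant) :
    0 ≤ (bananaDenominator x)⁻¹ ^ (n + 1) * ∏ i, (x i)⁻¹ :=
  mul_nonneg (pow_nonneg (inv_nonneg.2 (by linarith [bananaDenominator_ge hx])) _)
    (Finset.prod_nonneg fun i _ => (inv_pos.2 (hx i)).le)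

theorem measurable_bananaMoment_integrand (n : ℕ) :
    Measurable fun x : Fin 3 → ℝ => (bananaDenominator x)⁻¹ ^ (n + 1) * ∏ i, (x i)⁻¹ := by
  have := measurable_bananaDenominator
  fun_prop

/-- The moments converge, because the corresponding Bessel moments do. -/
theorem bananaMoment_spec (n : ℕ) :
    IntegrableOn (fun x : Fin 3 → ℝ => (bananaDenominator x)⁻¹ ^ (n + 1) * ∏ i, (x i)⁻¹)
        positiveOctant ∧
      (n.factorial : ℝ) ^ 2 * bananaMoment n = besselMoment n 4 0 := by
  have h := lintegral_bananaMoment n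
  have hi := integrableOn_besselMonomial n (a := 4) (b := 0) rfl
  have hnn : 0 ≤ᵐ[volume.restrict (Set.Ioi 0)] besselMonomial n 4 0 :=
    (ae_restrict_iff' measurableSet_Ioi).2 (.of_forall fun w hw => besselMonomial_nonneg _ _ _ hw)
  have hf : (n.factorial : ℝ) ^ 2 ≠ 0 := by positivity
  have hnn' : 0 ≤ᵐ[volume.restrict positiveOctant] fun x : Fin 3 → ℝ =>
      (n.factorial : ℝ) ^ 2 * ((bananaDenominator x)⁻¹ ^ (n + 1) * ∏ i, (x i)⁻¹) :=
    (ae_restrict_iff' measurableSet_positiveOctant).2 (.of_forall fun x hx =>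
      mul_nonneg (by positivity) (bananaMoment_integrand_nonneg n hx))
  have hm := (measurable_bananaMoment_integrand n).const_mul ((n.factorial : ℝ) ^ 2)
  constructor
  · have hfin : ∫⁻ x in positiveOctant, ENNReal.ofReal
        ((n.factorial : ℝ) ^ 2 * ((bananaDenominator x)⁻¹ ^ (n + 1) * ∏ i, (x i)⁻¹)) ≠ ⊤ := by
      rw [h, ← ofReal_integral_eq_lintegral_ofReal hi hnn]
      exact ENNReal.ofReal_ne_top
    have h2 := (lintegral_ofReal_ne_top_iff_integrable hm.aestronglyMeasurable hnn').1 hfin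
    exact (integrable_const_mul_iff (IsUnit.mk0 _ hf) _).1 h2
  · rw [bananaMoment, ← integral_const_mul, besselMoment,
      integral_eq_lintegral_of_nonneg_ae hnn' hm.aestronglyMeasurable,
      integral_eq_lintegral_of_nonneg_ae hnn hi.aestronglyMeasurable, h]

theorem bananaMoment_rec_zero : 64 * bananaMoment 1 - 4 * bananaMoment 0 = -24 := by
  have h := besselMoment_four_zero_rec_zero
  rw [← (bananaMoment_spec 0).2, ← (bananaMoment_spec 1).2] at h
  simpa using h

theorem bananaMoment_rec (n : ℕ) :
    (n + 1 : ℝ) ^ 3 * bananaMoment n -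
      2 * (2 * n + 3) * (5 * (n + 1) ^ 2 + 5 * (n + 1) + 2) * bananaMoment (n + 1) +
      64 * (n + 2) ^ 3 * bananaMoment (n + 2) = 0 := by
  have h := besselMoment_four_zero_rec n
  rw [← (bananaMoment_spec n).2, ← (bananaMoment_spec (n + 1)).2,
    ← (bananaMoment_spec (n + 2)).2, Nat.factorial_succ (n + 1), Nat.factorial_succ n] at h
  push_cast at h
  have hf : ((n + 1 : ℝ) ^ 2 * (n.factorial : ℝ) ^ 2) ≠ 0 := by positivity
  refine (mul_eq_zero.1 ?_).resolve_left hf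
  linear_combination h

/-! ### Derivatives of the banana integral on the cut plane -/

/-- The integral `∫ (P - t)^(-(k+1)) ∏ dxᵢ / xᵢ`, where `P` is `bananaDenominator`. -/
noncomputable def bananaPower (k : ℕ) (t : ℂ) : ℂ :=
  ∫ x in positiveOctant, ((bananaDenominator x : ℂ) - t)⁻¹ ^ (k + 1) * ((∏ i, (x i)⁻¹ : ℝ) : ℂ)

theorem bananaIntegrand_eq (t : ℂ) (x : Fin 3 → ℝ) :
    bananaIntegrand t x =
      ((bananaDenominator x : ℂ) - t)⁻¹ ^ (0 + 1) * ((∏ i, (x i)⁻¹ : ℝ) : ℂ) := by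
  simp [bananaIntegrand, bananaDenominator]

theorem bananaIntegral_eq : bananaIntegral = bananaPower 0 := by
  funext t
  simp only [bananaIntegral, bananaPower, bananaIntegrand_eq]

theorem bananaDomain_eq : bananaDomain = ((↑) '' Set.Ici (16 : ℝ) : Set ℂ)ᶜ := by
  ext t
  simp only [bananaDomain, Set.mem_ofPred_eq, Set.mem_compl_iff, Set.mem_image, Set.mem_Ici,
    not_exists, not_and]
  exact forall₂_congr fun _ _ => ne_comm

theorem isClosed_ofReal_image_Ici : IsClosed ((↑) '' Set.Ici (16 : ℝ) : Set ℂ) :=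
  Complex.isometry_ofReal.isClosedEmbedding.isClosedMap _ isClosed_Ici

theorem isOpen_bananaDomain : IsOpen bananaDomain := by
  rw [bananaDomain_eq]
  exact isClosed_ofReal_image_Ici.isOpen_compl

theorem mem_bananaDomain_of_norm_lt {t : ℂ} (ht : ‖t‖ < 16) : t ∈ bananaDomain := by
  rintro s hs rfl
  rw [Complex.norm_real, Real.norm_eq_abs] at ht
  linarith [le_abs_self s]

theorem isPreconnected_bananaDomain : IsPreconnected bananaDomain := by
  have hstar : StarConvex ℝ (0 : ℂ) bananaDomain := by
    rw [starConvex_zero_iff]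
    intro t ht a ha0 ha1 s hs h
    have ha : 0 < a := by
      refine ha0.lt_of_ne fun h0 => ?_
      rw [← h0, zero_smul] at h
      have : (0 : ℝ) = s := by exact_mod_cast h
      linarith
    refine ht (s / a) ?_ ?_
    · rw [le_div_iff₀ ha]
      nlinarith
    · have ha' : (a : ℂ) ≠ 0 := by exact_mod_cast ha.ne'
      rw [Complex.real_smul] at h
      push_cast
      rw [eq_div_iff ha', ← h, mul_comm]
  exact (hstar.isPathConnected (mem_bananaDomain_of_norm_lt (by simp))).isConnected.isPreconnected

/-- Locally uniformly in `t`, the denominator `p - t` is comparable to `p`. -/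
theorem exists_mul_le_norm_sub {t : ℂ} (ht : t ∈ bananaDomain) :
    ∃ ε > 0, ∃ c > 0, ∀ s ∈ Metric.ball t ε, ∀ p : ℝ, 16 ≤ p → c * p ≤ ‖(p : ℂ) - s‖ := by
  obtain ⟨ε, hε, hball⟩ := Metric.isOpen_iff.1 isOpen_bananaDomain t ht
  have hR : 0 < ‖t‖ + ε := by positivity
  refine ⟨ε / 2, half_pos hε, min (1 / 2) (ε / 2 / (2 * (‖t‖ + ε))), by positivity,
    fun s hs p hp => ?_⟩
  have hp0 : 0 < p := by linarith
  rw [Metric.mem_ball, dist_eq_norm] at hs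
  have hs' : ‖s‖ ≤ ‖t‖ + ε := by
    have := norm_add_le (s - t) t
    rw [sub_add_cancel] at this
    linarith
  -- For large `p` the term `s` is negligible; for bounded `p` the distance of `t` to the cut counts.
  rcases le_total (2 * (‖t‖ + ε)) p with h | h
  · have h1 := norm_sub_norm_le (p : ℂ) s
    rw [Complex.norm_real, Real.norm_of_nonneg hp0.le] at h1
    have h2 : min (1 / 2) (ε / 2 / (2 * (‖t‖ + ε))) * p ≤ 1 / 2 * p := by
      gcongr
      exact min_le_left _ _
    linarith
  · have h1 : ε ≤ ‖(p : ℂ) - t‖ := by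
      by_contra! hlt
      exact hball (by rwa [Metric.mem_ball, dist_eq_norm]) p hp rfl
    have h2 := norm_sub_le_norm_sub_add_norm_sub (p : ℂ) s t
    calc min (1 / 2) (ε / 2 / (2 * (‖t‖ + ε))) * p
        ≤ ε / 2 / (2 * (‖t‖ + ε)) * (2 * (‖t‖ + ε)) := by
          gcongr
          exact min_le_right _ _
      _ = ε / 2 := by field_simp
      _ ≤ ‖(p : ℂ) - s‖ := by linarith

theorem measurable_bananaPower_integrand (k : ℕ) (t : ℂ) :
    Measurable fun x : Fin 3 → ℝ =>
      ((bananaDenominator x : ℂ) - t)⁻¹ ^ (k + 1) * ((∏ i, (x i)⁻¹ : ℝ) : ℂ) := by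
  have := measurable_bananaDenominator
  fun_prop

theorem norm_bananaPower_integrand_le (k : ℕ) {c : ℝ} (hc : 0 < c) {t : ℂ}
    (ht : ∀ p : ℝ, 16 ≤ p → c * p ≤ ‖(p : ℂ) - t‖) {x : Fin 3 → ℝ} (hx : x ∈ positiveOctant) :
    ‖((bananaDenominator x : ℂ) - t)⁻¹ ^ (k + 1) * ((∏ i, (x i)⁻¹ : ℝ) : ℂ)‖ ≤
      c⁻¹ ^ (k + 1) * ((bananaDenominator x)⁻¹ ^ (k + 1) * ∏ i, (x i)⁻¹) := by
  have hp := bananaDenominator_ge hx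
  have hp0 : 0 < bananaDenominator x := by linarith
  have hw : 0 ≤ ∏ i, (x i)⁻¹ := Finset.prod_nonneg fun i _ => (inv_pos.2 (hx i)).le
  rw [norm_mul, norm_pow, norm_inv, Complex.norm_real, Real.norm_of_nonneg hw, ← mul_assoc,
    ← mul_pow, ← mul_inv]
  gcongr
  exact ht _ hp

theorem integrableOn_bananaPower_integrand (k : ℕ) {t : ℂ} (ht : t ∈ bananaDomain) :
    IntegrableOn (fun x : Fin 3 → ℝ =>
      ((bananaDenominator x : ℂ) - t)⁻¹ ^ (k + 1) * ((∏ i, (x i)⁻¹ : ℝ) : ℂ)) positiveOctant := by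
  obtain ⟨ε, hε, c, hc, h⟩ := exists_mul_le_norm_sub ht
  exact Integrable.mono' ((bananaMoment_spec k).1.const_mul (c⁻¹ ^ (k + 1)))
    (measurable_bananaPower_integrand k t).aestronglyMeasurable
    ((ae_restrict_iff' measurableSet_positiveOctant).2 (.of_forall fun x hx =>
      norm_bananaPower_integrand_le k hc (h t (Metric.mem_ball_self hε)) hx))

theorem hasDerivAt_bananaPower (k : ℕ) {t : ℂ} (ht : t ∈ bananaDomain) :
    HasDerivAt (bananaPower k) ((k + 1) * bananaPower (k + 1) t) t := by
  obtain ⟨ε, hε, c, hc, h⟩ := exists_mul_le_norm_sub ht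
  have key := (hasDerivAt_integral_of_dominated_loc_of_deriv_le
    (μ := volume.restrict positiveOctant) (𝕜 := ℂ) (x₀ := t) (s := Metric.ball t ε)
    (F := fun s x => ((bananaDenominator x : ℂ) - s)⁻¹ ^ (k + 1) * ((∏ i, (x i)⁻¹ : ℝ) : ℂ))
    (F' := fun s x => (k + 1) *
      (((bananaDenominator x : ℂ) - s)⁻¹ ^ (k + 1 + 1) * ((∏ i, (x i)⁻¹ : ℝ) : ℂ)))
    (bound := fun x => (k + 1) * (c⁻¹ ^ (k + 1 + 1) *
      ((bananaDenominator x)⁻¹ ^ (k + 1 + 1) * ∏ i, (x i)⁻¹)))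
    (Metric.ball_mem_nhds t hε)
    (.of_forall fun s => (measurable_bananaPower_integrand k s).aestronglyMeasurable)
    (integrableOn_bananaPower_integrand k ht)
    ((measurable_bananaPower_integrand (k + 1) t).const_mul _).aestronglyMeasurable
    ?_ (((bananaMoment_spec (k + 1)).1.const_mul _).const_mul _) ?_).2
  · rw [integral_const_mul] at key
    exact key
  · refine (ae_restrict_iff' measurableSet_positiveOctant).2 (.of_forall fun x hx s hs => ?_)
    have hk : ‖(k + 1 : ℂ)‖ = k + 1 := by exact_mod_cast Complex.norm_natCast (k + 1)
    rw [norm_mul, hk]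
    gcongr
    exact norm_bananaPower_integrand_le (k + 1) hc (h s hs) hx
  · refine (ae_restrict_iff' measurableSet_positiveOctant).2 (.of_forall fun x hx s hs => ?_)
    have hp := bananaDenominator_ge hx
    have hne : (bananaDenominator x : ℂ) - s ≠ 0 := by
      rw [← norm_pos_iff]
      have := h s hs _ hp
      have : 0 < c * bananaDenominator x := by positivity
      linarith
    refine (((((hasDerivAt_id s).const_sub (bananaDenominator x : ℂ)).inv hne).pow
      (k + 1)).mul_const _).congr_deriv ?_
    simp only [Nat.add_sub_cancel, id, Pi.inv_apply]
    rw [neg_neg, one_div, ← inv_pow, Nat.cast_succ]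
    ring

theorem iteratedDeriv_bananaIntegral (k : ℕ) {t : ℂ} (ht : t ∈ bananaDomain) :
    iteratedDeriv k bananaIntegral t = k.factorial * bananaPower k t := by
  induction k generalizing t with
  | zero => simp [bananaIntegral_eq]
  | succ k ih =>
    rw [iteratedDeriv_succ]
    have hev : iteratedDeriv k bananaIntegral =ᶠ[nhds t] fun s => k.factorial * bananaPower k s :=
      Filter.eventually_of_mem (isOpen_bananaDomain.mem_nhds ht) fun s hs => ih hs
    rw [hev.deriv_eq, ((hasDerivAt_bananaPower k ht).const_mul _).deriv, Nat.factorial_succ]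
    push_cast
    ring

theorem picardFuchsOperator_bananaIntegral {t : ℂ} (ht : t ∈ bananaDomain) :
    picardFuchsOperator bananaIntegral t =
      t ^ 2 * (t - 4) * (t - 16) * (6 * bananaPower 3 t)
        + 6 * t * (t ^ 2 - 15 * t + 32) * (2 * bananaPower 2 t)
        + (7 * t ^ 2 - 68 * t + 64) * bananaPower 1 t
        + (t - 4) * bananaPower 0 t := by
  have h1 := iteratedDeriv_bananaIntegral 1 ht
  rw [iteratedDeriv_one] at h1
  rw [picardFuchsOperator, iteratedDeriv_bananaIntegral 3 ht, iteratedDeriv_bananaIntegral 2 ht, h1,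
    bananaIntegral_eq]
  simp [Nat.factorial]

/-! ### The expansion at the origin and the differential equation -/

/-- The expansion of `t ^ k` times the `k`-th derivative of the banana integral. The power of `t`
keeps all these series on the same index, the terms with `m < k` being zero. -/
theorem hasSum_bananaPower (k : ℕ) {t : ℂ} (ht : ‖t‖ < 1) :
    HasSum (fun m : ℕ => (m.descFactorial k : ℂ) * (bananaMoment m * t ^ m))
      (t ^ k * (k.factorial * bananaPower k t)) := by
  have hae : ∀ {q : (Fin 3 → ℝ) → Prop}, (∀ x ∈ positiveOctant, q x) →
      ∀ᵐ x ∂volume.restrict positiveOctant, q x := fun h =>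
    (ae_restrict_iff' measurableSet_positiveOctant).2 (.of_forall h)
  let F : ℕ → (Fin 3 → ℝ) → ℂ := fun n x => (((n + k).choose k : ℂ) * t ^ n) *
    (((bananaDenominator x)⁻¹ ^ (n + k + 1) * ∏ i, (x i)⁻¹ : ℝ) : ℂ)
  have hFi : ∀ n, Integrable (F n) (volume.restrict positiveOctant) := fun n =>
    (bananaMoment_spec (n + k)).1.ofReal.const_mul _
  have hFn : ∀ n, ∫ x in positiveOctant, ‖F n x‖ ≤
      ‖((n + k).choose k : ℂ) * t ^ n‖ * bananaMoment 0 := fun n => by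
    rw [bananaMoment, ← integral_const_mul]
    refine integral_mono_ae (hFi n).norm ((bananaMoment_spec 0).1.const_mul _) (hae fun x hx => ?_)
    have hp := bananaDenominator_ge hx
    have hw : 0 ≤ ∏ i, (x i)⁻¹ := Finset.prod_nonneg fun i _ => (inv_pos.2 (hx i)).le
    simp only [F]
    rw [norm_mul, Complex.norm_real, Real.norm_of_nonneg (bananaMoment_integrand_nonneg (n + k) hx)]
    gcongr ?_ * (?_ * _)
    exact pow_le_pow_of_le_one (inv_nonneg.2 (by linarith)) (inv_le_one_of_one_le₀ (by linarith))
      (by omega)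
  have hsum : Summable fun n => ∫ x in positiveOctant, ‖F n x‖ :=
    Summable.of_nonneg_of_le (fun n => integral_nonneg fun x => norm_nonneg _) hFn
      ((hasSum_choose_mul_geometric_of_norm_lt_one k ht).summable.norm.mul_right _)
  have key := hasSum_integral_of_summable_integral_norm hFi hsum
  have hlim : ∫ x in positiveOctant, ∑' n, F n x = bananaPower k t := by
    refine setIntegral_congr_fun measurableSet_positiveOctant fun x hx => ?_
    have hp := bananaDenominator_ge hx
    have hp0 : (bananaDenominator x : ℂ) ≠ 0 := by
      exact_mod_cast (by linarith : (0 : ℝ) < bananaDenominator x).ne'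
    have hr : ‖t * (bananaDenominator x : ℂ)⁻¹‖ < 1 := by
      rw [norm_mul, norm_inv, Complex.norm_real, Real.norm_of_nonneg (by linarith)]
      exact (mul_le_of_le_one_right (norm_nonneg t)
        (inv_le_one_of_one_le₀ (by linarith))).trans_lt ht
    have hg := ((hasSum_choose_mul_geometric_of_norm_lt_one k hr).mul_left
      ((bananaDenominator x : ℂ)⁻¹ ^ (k + 1) * ((∏ i, (x i)⁻¹ : ℝ) : ℂ)))
    have hval : (bananaDenominator x : ℂ)⁻¹ ^ (k + 1) * ((∏ i, (x i)⁻¹ : ℝ) : ℂ) *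
        (1 / (1 - t * (bananaDenominator x : ℂ)⁻¹) ^ (k + 1)) =
        ((bananaDenominator x : ℂ) - t)⁻¹ ^ (k + 1) * ((∏ i, (x i)⁻¹ : ℝ) : ℂ) := by
      have : (bananaDenominator x : ℂ) - t =
          bananaDenominator x * (1 - t * (bananaDenominator x : ℂ)⁻¹) := by field_simp
      rw [this, mul_inv, mul_pow, one_div, inv_pow (1 - t * (bananaDenominator x : ℂ)⁻¹)]
      ring
    rw [hval] at hg
    rw [← hg.tsum_eq]
    refine tsum_congr fun n => ?_
    simp only [F]
    push_cast
    ring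
  rw [hlim] at key
  have hinj : Function.Injective fun n : ℕ => n + k := add_left_injective k
  refine (hinj.hasSum_iff fun m hm => ?_).1 ?_
  · have : m < k := by
      by_contra! hle
      exact hm ⟨m - k, Nat.sub_add_cancel hle⟩
    rw [Nat.descFactorial_eq_zero_iff_lt.2 this]
    simp
  · have hint : ∀ n, ∫ x in positiveOctant, F n x =
        ((n + k).choose k : ℂ) * t ^ n * bananaMoment (n + k) := fun n => by
      rw [integral_const_mul, integral_complex_ofReal, bananaMoment]
    simp_rw [hint] at key
    rw [← mul_assoc]
    refine (key.mul_left (t ^ k * k.factorial)).congr_fun fun n => ?_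
    simp only [Function.comp_apply]
    rw [Nat.descFactorial_eq_factorial_mul_choose]
    push_cast
    ring

theorem cast_descFactorial_two_three (m : ℕ) :
    (m.descFactorial 2 : ℂ) = m * (m - 1) ∧
      (m.descFactorial 3 : ℂ) = m * (m - 1) * (m - 2) := by
  rcases m with _ | _ | m
  · simp
  · simp [Nat.descFactorial]
  · simp only [Nat.descFactorial, Nat.sub_zero, Nat.add_sub_cancel]
    push_cast
    constructor <;> ring

/-- Near the origin the differential equation is the recurrence for the Taylor coefficients. -/
theorem picardFuchsOperator_bananaIntegral_of_norm_lt_one {t : ℂ} (ht : ‖t‖ < 1) (ht0 : t ≠ 0) :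
    picardFuchsOperator bananaIntegral t = -24 := by
  have s0 := hasSum_bananaPower 0 ht
  have s1 := hasSum_bananaPower 1 ht
  have s2 := hasSum_bananaPower 2 ht
  have s3 := hasSum_bananaPower 3 ht
  let c : ℕ → ℂ := fun m => bananaMoment m * t ^ m
  -- `t` times the operator acts on `t ^ m` as `t ^ 2 (m + 1) ^ 3 - t b m + 64 m ^ 3`, with
  -- `b m = 2 (2 m + 1) (5 m ^ 2 + 5 m + 2)`.
  have hA : HasSum (fun m : ℕ => ((m : ℂ) + 1) ^ 3 * c m)
      (t ^ 3 * (6 * bananaPower 3 t) + 6 * (t ^ 2 * (2 * bananaPower 2 t)) +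
        7 * (t * bananaPower 1 t) + bananaPower 0 t) := by
    convert! ((s3.add (s2.mul_left 6)).add (s1.mul_left 7)).add s0 using 1
    · funext m
      obtain ⟨h2, h3⟩ := cast_descFactorial_two_three m
      rw [h2, h3, Nat.descFactorial_one, Nat.descFactorial_zero]
      simp only [c]
      push_cast
      ring
    · simp [Nat.factorial]
  have hB : HasSum (fun m : ℕ => 2 * (2 * (m : ℂ) + 1) * (5 * (m : ℂ) ^ 2 + 5 * m + 2) * c m)
      (20 * (t ^ 3 * (6 * bananaPower 3 t)) + 90 * (t ^ 2 * (2 * bananaPower 2 t)) +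
        68 * (t * bananaPower 1 t) + 4 * bananaPower 0 t) := by
    convert! (((s3.mul_left 20).add (s2.mul_left 90)).add (s1.mul_left 68)).add
      (s0.mul_left 4) using 1
    · funext m
      obtain ⟨h2, h3⟩ := cast_descFactorial_two_three m
      rw [h2, h3, Nat.descFactorial_one, Nat.descFactorial_zero]
      simp only [c]
      push_cast
      ring
    · simp [Nat.factorial]
  have hC : HasSum (fun m : ℕ => 64 * (m : ℂ) ^ 3 * c m)
      (64 * (t ^ 3 * (6 * bananaPower 3 t)) + 192 * (t ^ 2 * (2 * bananaPower 2 t)) +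
        64 * (t * bananaPower 1 t)) := by
    convert! ((s3.mul_left 64).add (s2.mul_left 192)).add (s1.mul_left 64) using 1
    · funext m
      obtain ⟨h2, h3⟩ := cast_descFactorial_two_three m
      rw [h2, h3, Nat.descFactorial_one]
      simp only [c]
      ring
    · simp [Nat.factorial]
  -- The series are aligned at `t ^ (m + 2)`; the terms split off are `b 0 a₀ = 4 a₀` in `hB` and
  -- `64 a₁ t` in `hC`.
  have hB' := ((hasSum_nat_add_iff' 1).2 hB).mul_left t
  have hC' := (hasSum_nat_add_iff' 2).2 hC
  have hzero := ((hA.mul_left (t ^ 2)).sub hB').add hC'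
  have hterm : ∀ m : ℕ, t ^ 2 * (((m : ℂ) + 1) ^ 3 * c m) -
      t * (2 * (2 * ((m + 1 : ℕ) : ℂ) + 1) *
        (5 * ((m + 1 : ℕ) : ℂ) ^ 2 + 5 * ((m + 1 : ℕ) : ℂ) + 2) * c (m + 1)) +
      64 * ((m + 2 : ℕ) : ℂ) ^ 3 * c (m + 2) = 0 := fun m => by
    have h : ((m : ℂ) + 1) ^ 3 * bananaMoment m -
        2 * (2 * m + 3) * (5 * ((m : ℂ) + 1) ^ 2 + 5 * (m + 1) + 2) * bananaMoment (m + 1) +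
        64 * ((m : ℂ) + 2) ^ 3 * bananaMoment (m + 2) = 0 := by
      exact_mod_cast bananaMoment_rec m
    simp only [c]
    push_cast
    linear_combination t ^ (m + 2) * h
  have hval := hzero.unique ((hasSum_zero (α := ℂ) (β := ℕ)).congr_fun hterm)
  have hrec : 64 * (bananaMoment 1 : ℂ) - 4 * bananaMoment 0 = -24 := by
    exact_mod_cast bananaMoment_rec_zero
  simp only [Finset.sum_range_succ, Finset.sum_range_zero, c] at hval
  push_cast at hval
  rw [picardFuchsOperator_bananaIntegral (mem_bananaDomain_of_norm_lt (by linarith))]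
  refine mul_left_cancel₀ ht0 ?_
  linear_combination hval + t * hrec

theorem theoreme :
    (∀ t ∈ bananaDomain, IntegrableOn (bananaIntegrand t) positiveOctant) ∧
    DifferentiableOn ℂ bananaIntegral bananaDomain ∧
    ∀ t ∈ bananaDomain, picardFuchsOperator bananaIntegral t = -24 := by
  have hdiff : ∀ k, DifferentiableOn ℂ (bananaPower k) bananaDomain := fun k t ht =>
    (hasDerivAt_bananaPower k ht).differentiableAt.differentiableWithinAt
  refine ⟨fun t ht => ?_, bananaIntegral_eq ▸ hdiff 0, ?_⟩
  · exact (integrableOn_bananaPower_integrand 0 ht).congr_fun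
      (fun x _ => (bananaIntegrand_eq t x).symm) measurableSet_positiveOctant
  · have hL : DifferentiableOn ℂ (picardFuchsOperator bananaIntegral) bananaDomain := by
      have h0 := hdiff 0
      have h1 := hdiff 1
      have h2 := hdiff 2
      have h3 := hdiff 3
      exact DifferentiableOn.congr (by fun_prop) fun t ht => picardFuchsOperator_bananaIntegral ht
    have hmem : (1 / 2 : ℂ) ∈ bananaDomain := mem_bananaDomain_of_norm_lt (by norm_num)
    -- The identity theorem is applied around `1 / 2` since the power series argument excludes `0`.
    refine AnalyticOnNhd.eqOn_of_preconnected_of_eventuallyEq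
      (hL.analyticOnNhd isOpen_bananaDomain) analyticOnNhd_const isPreconnected_bananaDomain hmem ?_
    have hball : Metric.ball (0 : ℂ) 1 ∩ {0}ᶜ ∈ nhds (1 / 2 : ℂ) :=
      (Metric.isOpen_ball.inter isOpen_compl_singleton).mem_nhds ⟨by simp; norm_num, by norm_num⟩
    filter_upwards [hball] with t ht
    exact picardFuchsOperator_bananaIntegral_of_norm_lt_one (by simpa using ht.1) ht.2
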